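/- Let $A\in\mathbb R^{m\times n}$ be a matrix of full column rank (rank $n$). All vector spaces carry the Euclidean norm and matrices the induced operator norm. Let $\mathscr D$ be the set of $m\times m$ diagonal matrices with positive diagonal entries, let $\mathbb S=\{\operatorname{Diag}(s): s\in\{-1,1\}^m\}$ be the set of signature matrices, and let $\mathbb R^m_{+}$ and $\mathbb R^m_{++}$ be the sets of vectors in $\mathbb R^m$ with nonnegative, respectively positive, entries. Define $$\chi(A)=\sup_{D\in\mathscr D}\big\|(A^{\mathsf T}DA)^{-1}A^{\mathsf T}D\big\|,$$ and for any matrix $B\in\mathbb R^{p\times n}$ define $$H(B)=\sup\left\{\frac{\operatorname{dist}(x,P_B(b))}{\|(Bx-b)_+\|} : b\in B(\mathbb R^n)+\mathbb R^p_+,\ x\in\mathbb R^n\setminus P_B(b)\right\},\qquad P_B(b)=\{x\in\mathbb R^n: Bx\le b\},$$ where $\operatorname{dist}$ is the Euclidean distance to a set, $(\cdot)_+$ is the componentwise positive part, and the supremum of the empty set is $0$ (this convention matters only when $n=0$). Then $\chi(A)$, all $H(SA)$ with $S\in\mathbb S$, and $H\begin{pmatrix}A\\-A\end{pmatrix}$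 are finite, and $$\chi(A)=\max_{S\in\mathbb S}H(SA)=H\begin{pmatrix}A\\-A\end{pmatrix}.$$ Furthermore, if all rows of $A$ are nonzero, then $$\chi(A)=\max_{S\in\mathbb S,\ SA(\mathbb R^n)\cap\mathbb R^m_{++}\neq\emptyset}H(SA),$$ where the maximum is over a nonempty set of signature matrices. -/

import Mathlib

namespace ChiHoffman

section
open scoped Matrix Pointwise Matrix.Norms.L2Operator

variable {ι κ : Type*} [Fintype ι] [DecidableEq ι] [Fintype κ] [DecidableEq κ]

/-- Diagonal matrices with positive diagonal entries. -/
def posDiag (ι : Type*) [DecidableEq ι] : Set (Matrix ι ι ℝ) :=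
  {D | ∃ d : ι → ℝ, (∀ i, 0 < d i) ∧ D = Matrix.diagonal d}

/-- Signature matrices: diagonal matrices with diagonal entries in `{-1, 1}`. -/
def signature (ι : Type*) [DecidableEq ι] : Set (Matrix ι ι ℝ) :=
  {S | ∃ s : ι → ℝ, (∀ i, s i = -1 ∨ s i = 1) ∧ S = Matrix.diagonal s}

/-- The nonnegative orthant. -/
def nonnegOrthant (ι : Type*) : Set (EuclideanSpace ℝ ι) := {y | ∀ i, 0 ≤ y i}

/-- The open positive orthant. -/
def posOrthant (ι : Type*) : Set (EuclideanSpace ℝ ι) := {y | ∀ i, 0 < y i}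

/-- The image `A(ℝⁿ)`. -/
def image (A : Matrix ι κ ℝ) : Set (EuclideanSpace ℝ ι) := Set.range A.toEuclideanLin

/-- The weighted pseudo-inverse `(Aᵀ D A)⁻¹ Aᵀ D`. -/
noncomputable def weightedPinv (A : Matrix ι κ ℝ) (D : Matrix ι ι ℝ) : Matrix κ ι ℝ :=
  (Aᵀ * D * A)⁻¹ * Aᵀ * D

/-- The Euclidean operator norms of the weighted pseudo-inverses of `A`, over all positive
diagonal weights. -/
def chiValues (A : Matrix ι κ ℝ) : Set ℝ :=
  {r | ∃ D ∈ posDiag ι, r = ‖weightedPinv A D‖}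

/-- The chi constant. -/
noncomputable def chi (A : Matrix ι κ ℝ) : ℝ := sSup (chiValues A)

/-- The polyhedron `{x | A x ≤ b}`. -/
def polyhedron (A : Matrix ι κ ℝ) (b : EuclideanSpace ℝ ι) : Set (EuclideanSpace ℝ κ) :=
  {x | ∀ i, A.toEuclideanLin x i ≤ b i}

/-- The componentwise positive part `y₊`. -/
noncomputable def positivePart (y : EuclideanSpace ℝ ι) : EuclideanSpace ℝ ι :=
  WithLp.toLp 2 fun i => max (y i) 0

/-- The ratios `dist(x, P_A(b)) / ‖(A x - b)₊‖` over all `b ∈ A(ℝⁿ) + ℝᵐ₊` and all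
`x ∉ P_A(b)`. -/
def hoffmanValues (A : Matrix ι κ ℝ) : Set ℝ :=
  {r | ∃ b ∈ image A + nonnegOrthant ι, ∃ x ∉ polyhedron A b,
    r = Metric.infDist x (polyhedron A b) / ‖positivePart (A.toEuclideanLin x - b)‖}

/-- The Hoffman constant. -/
noncomputable def hoffman (A : Matrix ι κ ℝ) : ℝ := sSup (hoffmanValues A)

end

end ChiHoffman

set_option linter.unusedSectionVars false

/-! All the constants equal M, the maximum of 1/σ_min(A_J) over the row sets J for which A_J is
injective (for n > 0). M depends on the rows only up to sign and repetition, so it is the same for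
A, SA and (A; -A).

Upper bounds. A weighted least squares solution lies in the polyhedron cut out by the signs of its
residual. A point of maximal norm there satisfies (Ly)_J = b_J for a determining J, so `RowBound`
applies (`norm_le_of_weighted_normal_equations`). For Hoffman, a penalised projection displaces x by
a conic combination of violated rows. Carathéodory makes these rows independent, and extending them
to a determining J gives a bound independent of the penalty (`norm_le_of_conic`,
`exists_feasible_norm_sub_le`).

Lower bounds. Let J and y attain M. Concentrating the weights on J gives chi ≥ M
(`norm_le_of_weighted_solutions_le`). Since A_Jᵀ A_J y = σ² y, signs making Ay nonnegative put y in
the cone of the signed rows in J. Hence 0 is the projection of y onto a suitable polyhedron, and the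
Hoffman ratio at y is M (`mem_hoffmanValues`). -/

namespace ChiHoffman

/-! ### Row bounds and weighted least squares -/

section RowBounds

variable {ι E : Type*} [Fintype ι] [NormedAddCommGroup E] [InnerProductSpace ℝ E]

/-- The coordinates in `J` determine the argument of `L`. -/
def Determines (L : E →ₗ[ℝ] EuclideanSpace ℝ ι) (J : Finset ι) : Prop :=
  ∀ y, (∀ i ∈ J, L y i = 0) → y = 0

/-- The Euclidean norm of the coordinates of `v` in `J`. -/
noncomputable def partNorm (J : Finset ι) (v : EuclideanSpace ℝ ι) : ℝ :=
  √(∑ i ∈ J, v i ^ 2)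

/-- `C` bounds the inverse of every injective row restriction of `L`. -/
def RowBound (L : E →ₗ[ℝ] EuclideanSpace ℝ ι) (C : ℝ) : Prop :=
  ∀ J, Determines L J → ∀ y, ‖y‖ ≤ C * partNorm J (L y)

lemma partNorm_nonneg (J : Finset ι) (v : EuclideanSpace ℝ ι) : 0 ≤ partNorm J v :=
  Real.sqrt_nonneg _

lemma partNorm_sq (J : Finset ι) (v : EuclideanSpace ℝ ι) :
    partNorm J v ^ 2 = ∑ i ∈ J, v i ^ 2 :=
  Real.sq_sqrt (Finset.sum_nonneg fun _ _ => sq_nonneg _)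

lemma partNorm_le_norm (J : Finset ι) {v w : EuclideanSpace ℝ ι} (h : ∀ i ∈ J, v i ^ 2 ≤ w i ^ 2) :
    partNorm J v ≤ ‖w‖ := by
  rw [EuclideanSpace.norm_eq]
  apply Real.sqrt_le_sqrt
  calc ∑ i ∈ J, v i ^ 2 ≤ ∑ i ∈ J, w i ^ 2 := Finset.sum_le_sum h
    _ ≤ ∑ i, w i ^ 2 :=
        Finset.sum_le_sum_of_subset_of_nonneg (Finset.subset_univ _) fun _ _ _ => sq_nonneg _
    _ = ∑ i, ‖w i‖ ^ 2 := by simp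

lemma partNorm_smul (J : Finset ι) (c : ℝ) (v : EuclideanSpace ℝ ι) :
    partNorm J (c • v) = |c| * partNorm J v := by
  unfold partNorm
  rw [← Real.sqrt_sq_eq_abs, ← Real.sqrt_mul (sq_nonneg c), Finset.mul_sum]
  simp [mul_pow]

lemma continuous_partNorm (J : Finset ι) : Continuous (partNorm J) := by
  unfold partNorm; fun_prop

lemma partNorm_pos {L : E →ₗ[ℝ] EuclideanSpace ℝ ι} {J : Finset ι} (hJ : Determines L J) {y : E}
    (hy : y ≠ 0) : 0 < partNorm J (L y) := by
  by_contra! h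
  refine hy (hJ y fun i hi => ?_)
  have h0 : partNorm J (L y) = 0 := le_antisymm h (partNorm_nonneg _ _)
  have h1 := partNorm_sq J (L y)
  rw [h0, eq_comm, zero_pow two_ne_zero,
    Finset.sum_eq_zero_iff_of_nonneg fun _ _ => sq_nonneg _] at h1
  exact pow_eq_zero_iff two_ne_zero |>.1 (h1 i hi)

lemma Determines.injective {L : E →ₗ[ℝ] EuclideanSpace ℝ ι} {J : Finset ι}
    (hJ : Determines L J) : Function.Injective L := by
  rw [injective_iff_map_eq_zero]
  intro y hy
  exact hJ y fun i _ => by simp [hy]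

lemma determines_univ {L : E →ₗ[ℝ] EuclideanSpace ℝ ι} (hL : Function.Injective L) :
    Determines L Finset.univ := fun y hy => by
  apply hL
  ext i
  simpa using hy i (Finset.mem_univ i)

/-- A linear form perturbing a nonnegative quadratic without increasing it vanishes. -/
lemma eq_zero_of_quadratic_nonneg {G Q : ℝ} (h : ∀ t : ℝ, 0 ≤ 2 * t * G + t ^ 2 * Q) : G = 0 := by
  by_contra hG
  have hQ : 0 ≤ Q := by
    have h1 := h 1
    have h2 := h (-1)
    nlinarith
  -- Nearly the minimiser -G/Q; the shift by 1 covers Q = 0.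
  have h3 := h (-G / (Q + 1))
  have h4 : 2 * (-G / (Q + 1)) * G + (-G / (Q + 1)) ^ 2 * Q = -(G ^ 2 * (Q + 2)) / (Q + 1) ^ 2 := by
    field_simp
    ring
  rw [h4] at h3
  have : 0 < G ^ 2 * (Q + 2) / (Q + 1) ^ 2 := by positivity
  rw [neg_div] at h3
  linarith

lemma norm_add_smul_sq (y z : E) (t : ℝ) :
    ‖y + t • z‖ ^ 2 = ‖y‖ ^ 2 + 2 * t * inner ℝ y z + t ^ 2 * ‖z‖ ^ 2 := by
  rw [norm_add_sq_real, inner_smul_right, norm_smul, mul_pow, Real.norm_eq_abs, sq_abs]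
  ring

variable [FiniteDimensional ℝ E]

/-- In a bounded closed set of points satisfying finitely many affine constraints, a point of
maximal norm has a determining set of active constraints. Here the constraints are the signs of the
residual of a weighted least squares solution `x`. -/
lemma norm_le_of_weighted_normal_equations {L : E →ₗ[ℝ] EuclideanSpace ℝ ι}
    (hL : Function.Injective L) {C : ℝ} (hC0 : 0 ≤ C) (hC : RowBound L C) {d : ι → ℝ}
    (hd : ∀ i, 0 < d i) {x : E} {b : EuclideanSpace ℝ ι}
    (hx : ∀ z, ∑ i, d i * (L x i - b i) * L z i = 0) : ‖x‖ ≤ C * ‖b‖ := by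
  classical
  set r : ι → ℝ := fun i => L x i - b i with hr
  have hLc : Continuous L := L.continuous_of_finiteDimensional
  have hLci (i : ι) : Continuous fun y => L y i := by fun_prop
  let Q : Set E := {y | ∀ i, (r i = 0 → L y i = b i) ∧ 0 ≤ r i * (L y i - b i)}
  have hxQ : x ∈ Q := fun i => ⟨fun h => by simpa [hr, sub_eq_zero] using h,
    by simpa [hr] using mul_self_nonneg (L x i - b i)⟩
  set T : ℝ := ∑ i, d i * r i * r i with hT
  have hT0 : 0 ≤ T := Finset.sum_nonneg fun i _ => by
    rw [mul_assoc]; exact mul_nonneg (hd i).le (mul_self_nonneg _)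
  -- Testing the normal equations with y - x makes this sum constant. On Q its terms are
  -- nonnegative, so each is at most T, which bounds Q.
  have hsum (y : E) : ∑ i, d i * r i * (L y i - b i) = T := by
    have := hx (y - x)
    rw [hT, ← sub_eq_zero, ← Finset.sum_sub_distrib, ← this]
    refine Finset.sum_congr rfl fun i _ => ?_
    simp only [hr, map_sub, PiLp.sub_apply]
    ring
  have hbound (y : E) (hy : y ∈ Q) (i : ι) : |L y i - b i| ≤ T / (d i * |r i|) := by
    by_cases hi : r i = 0
    · simp [(hy i).1 hi, hi]
    · have hpos : 0 < d i * |r i| := mul_pos (hd i) (abs_pos.2 hi)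
      rw [le_div_iff₀ hpos, ← hsum y]
      have h1 : |L y i - b i| * (d i * |r i|) = d i * r i * (L y i - b i) := by
        rw [mul_assoc (d i), ← abs_of_nonneg (hy i).2, abs_mul]; ring
      rw [h1]
      exact Finset.single_le_sum
        (f := fun i => d i * r i * (L y i - b i))
        (fun j _ => by rw [mul_assoc]; exact mul_nonneg (hd j).le (hy j).2) (Finset.mem_univ i)
  have hclosed : IsClosed Q := by
    have : Q = ⋂ i, ({y | r i = 0 → L y i = b i} ∩ {y | 0 ≤ r i * (L y i - b i)}) := by
      ext y; simp [Q]
    rw [this]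
    refine isClosed_iInter fun i => IsClosed.inter ?_ ?_
    · by_cases hi : r i = 0
      · simpa [hi] using isClosed_eq (hLci i) continuous_const
      · simp [hi]
    · exact isClosed_le continuous_const (by fun_prop)
  have hbdd : Bornology.IsBounded Q := by
    obtain ⟨K, -, hK⟩ := L.injective_iff_antilipschitz.1 hL
    rw [isBounded_iff_forall_norm_le]
    refine ⟨K * √(∑ i, (|b i| + T / (d i * |r i|)) ^ 2), fun y hy => ?_⟩
    have h1 : ‖y‖ ≤ K * ‖L y‖ := by
      have := hK.le_mul_dist y 0
      simpa using this
    refine h1.trans (mul_le_mul_of_nonneg_left ?_ K.2)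
    rw [EuclideanSpace.norm_eq]
    refine Real.sqrt_le_sqrt (Finset.sum_le_sum fun i _ => ?_)
    have h2 : ‖L y i‖ ≤ |b i| + T / (d i * |r i|) := by
      have := hbound y hy i
      have h3 := abs_add_le (b i) (L y i - b i)
      rw [add_sub_cancel] at h3
      rw [Real.norm_eq_abs]; linarith
    exact pow_le_pow_left₀ (norm_nonneg _) h2 2
  have hcomp : IsCompact Q := Metric.isCompact_of_isClosed_isBounded hclosed hbdd
  obtain ⟨y, hyQ, hymax⟩ := hcomp.exists_isMaxOn ⟨x, hxQ⟩ continuous_norm.continuousOn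
  let J : Finset ι := Finset.univ.filter fun i => L y i = b i
  -- If Lz vanishes on J, then y ± tz stay in Q for small t, because the other constraints are
  -- strict at y. Adding the two norm inequalities forces z = 0.
  have hJ : Determines L J := by
    intro z hz
    have hev : ∀ᶠ t in nhds (0 : ℝ), y + t • z ∈ Q := by
      change ∀ᶠ t in nhds (0 : ℝ), ∀ i, _
      rw [Filter.eventually_all]
      intro i
      by_cases hi : L y i = b i
      · have hzi : L z i = 0 := hz i (by simp [J, hi])
        exact Filter.Eventually.of_forall fun t => by simp [hzi, hi]
      · have hri : r i ≠ 0 := fun h => hi ((hyQ i).1 h)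
        have hpos : 0 < r i * (L (y + (0 : ℝ) • z) i - b i) := by
          rw [zero_smul, add_zero]
          exact lt_of_le_of_ne (hyQ i).2 (mul_ne_zero hri (sub_ne_zero.2 hi)).symm
        have hcont : Continuous fun t : ℝ => r i * (L (y + t • z) i - b i) := by fun_prop
        filter_upwards [hcont.continuousAt.eventually (lt_mem_nhds hpos)] with t ht
        exact ⟨fun h => absurd h hri, ht.le⟩
    have hev' : ∀ᶠ t in nhds (0 : ℝ), y + (-t) • z ∈ Q := by
      have : Filter.Tendsto (fun t : ℝ => -t) (nhds 0) (nhds 0) := by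
        simpa using (continuous_neg (G := ℝ)).tendsto 0
      exact this.eventually hev
    obtain ⟨t, ⟨h1, h2⟩, ht⟩ := ((hev.and hev').filter_mono nhdsWithin_le_nhds |>.and
      (self_mem_nhdsWithin : _ ∈ nhdsWithin (0 : ℝ) (Set.Ioi 0))).exists
    have ht : 0 < t := ht
    have n1 : ‖y + t • z‖ ^ 2 ≤ ‖y‖ ^ 2 := pow_le_pow_left₀ (norm_nonneg _) (hymax h1) 2
    have n2 : ‖y + (-t) • z‖ ^ 2 ≤ ‖y‖ ^ 2 := pow_le_pow_left₀ (norm_nonneg _) (hymax h2) 2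
    rw [norm_add_smul_sq] at n1 n2
    have n3 : t ^ 2 * ‖z‖ ^ 2 ≤ 0 := by nlinarith
    have n4 : ‖z‖ ^ 2 ≤ 0 := nonpos_of_mul_nonpos_right n3 (by positivity)
    have n5 : ‖z‖ = 0 := by
      have := le_antisymm n4 (sq_nonneg _)
      exact pow_eq_zero_iff two_ne_zero |>.1 this
    exact norm_eq_zero.1 n5
  calc ‖x‖ ≤ ‖y‖ := hymax hxQ
    _ ≤ C * partNorm J (L y) := hC J hJ y
    _ ≤ C * ‖b‖ := mul_le_mul_of_nonneg_left (partNorm_le_norm _ fun i hi => by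
        rw [(Finset.mem_filter.1 hi).2]) hC0

end RowBounds

/-! ### Conic combinations of independent vectors -/

/-- Carathéodory's theorem for cones. -/
lemma exists_linearIndepOn_nonneg_sum {ι V : Type*} [AddCommGroup V] [Module ℝ V] (φ : ι → V)
    (K : Finset ι) (c : ι → ℝ) (hc : ∀ i ∈ K, 0 ≤ c i) :
    ∃ K' ⊆ K, LinearIndepOn ℝ φ (K' : Set ι) ∧ ∃ c' : ι → ℝ, (∀ i ∈ K', 0 ≤ c' i) ∧
      ∑ i ∈ K', c' i • φ i = ∑ i ∈ K, c i • φ i := by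
  classical
  induction K using Finset.strongInduction generalizing c with
  | H K ih =>
  by_cases hK : LinearIndepOn ℝ φ (K : Set ι)
  · exact ⟨K, subset_rfl, hK, c, hc, rfl⟩
  obtain ⟨g, hg, i₀, hi₀, hgi₀⟩ : ∃ g : ι → ℝ, ∑ i ∈ K, g i • φ i = 0 ∧ ∃ i ∈ K, 0 < g i := by
    rw [linearIndepOn_finset_iff] at hK
    push Not at hK
    obtain ⟨g, hg, i, hi, hne⟩ := hK
    rcases lt_or_gt_of_ne hne with h | h
    · exact ⟨-g, by simp [hg], i, hi, by simpa using h⟩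
    · exact ⟨g, hg, i, hi, h⟩
  -- Ratio test: subtracting t times the relation g keeps all coefficients nonnegative and kills
  -- that of j.
  obtain ⟨j, hj, hmin⟩ := (K.filter fun i => 0 < g i).exists_min_image (fun i => c i / g i)
    ⟨i₀, by simp [hi₀, hgi₀]⟩
  obtain ⟨hjK, hgj⟩ := Finset.mem_filter.1 hj
  set t := c j / g j
  have ht : 0 ≤ t := div_nonneg (hc j hjK) hgj.le
  have hcj : c j - t * g j = 0 := by simp only [t]; field_simp; ring
  obtain ⟨K', hK', hli, c', hc', hsum⟩ := ih (K.erase j) (Finset.erase_ssubset hjK)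
    (fun i => c i - t * g i) (fun i hi => by
      have hiK := Finset.mem_of_mem_erase hi
      rcases lt_or_ge 0 (g i) with h | h
      · have := hmin i (by simp [hiK, h])
        rw [le_div_iff₀ h] at this
        linarith
      · nlinarith [hc i hiK])
  refine ⟨K', hK'.trans (Finset.erase_subset _ _), hli, c', hc', hsum.trans ?_⟩
  rw [Finset.sum_erase K (by rw [hcj, zero_smul])]
  simp only [sub_smul, Finset.sum_sub_distrib, mul_smul, ← Finset.smul_sum, hg, smul_zero, sub_zero]

/-! ### Hoffman error bounds from row bounds -/

section HoffmanBound

variable {ι E : Type*} [Fintype ι] [NormedAddCommGroup E] [InnerProductSpace ℝ E]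

/-- The `i`-th coordinate of `L`, as a linear form. -/
def rowForm (L : E →ₗ[ℝ] EuclideanSpace ℝ ι) (i : ι) : Module.Dual ℝ E where
  toFun y := L y i
  map_add' := by simp
  map_smul' := by simp

variable [FiniteDimensional ℝ E]

/-- Independent linear forms take arbitrary values. -/
lemma exists_forall_apply_eq {φ : ι → Module.Dual ℝ E} {J : Set ι} (hJ : LinearIndepOn ℝ φ J)
    (r : ι → ℝ) : ∃ y, ∀ i ∈ J, φ i y = r i := by
  obtain ⟨g, hg⟩ := (Finsupp.linearCombination ℝ fun i : J => φ i).exists_leftInverse_of_injective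
    (LinearMap.ker_eq_bot.2 hJ)
  let ψ : Module.Dual ℝ (Module.Dual ℝ E) :=
    (Finsupp.linearCombination ℝ fun i : J => r i) ∘ₗ g
  refine ⟨(Module.evalEquiv ℝ E).symm ψ, fun i hi => ?_⟩
  rw [Module.apply_evalEquiv_symm_apply]
  have h1 : g (φ i) = Finsupp.single ⟨i, hi⟩ 1 := by
    have := LinearMap.congr_fun hg (Finsupp.single ⟨i, hi⟩ 1)
    simpa using this
  simp [ψ, h1]

/-- Independent rows extend to a determining set of independent rows. -/
lemma exists_determines_extension {L : E →ₗ[ℝ] EuclideanSpace ℝ ι} (hL : Function.Injective L)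
    {K : Finset ι} (hK : LinearIndepOn ℝ (rowForm L) (K : Set ι)) :
    ∃ J : Finset ι, K ⊆ J ∧ LinearIndepOn ℝ (rowForm L) (J : Set ι) ∧ Determines L J := by
  classical
  obtain ⟨J, -, hKJ, hspan, hJ⟩ := exists_linearIndepOn_extension hK (Set.subset_univ _)
  refine ⟨J.toFinset, ?_, by simpa using hJ, fun y hy => ?_⟩
  · intro i hi; simpa using hKJ hi
  · apply hL
    ext i
    have h1 : rowForm L i ∈ Submodule.span ℝ (rowForm L '' J) := hspan ⟨i, trivial, rfl⟩
    have h2 : Submodule.span ℝ (rowForm L '' J) ≤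
        LinearMap.ker (Module.Dual.eval ℝ E y) := by
      rw [Submodule.span_le]
      rintro _ ⟨j, hj, rfl⟩
      exact hy j (by simpa using hj)
    have h3 : L y i = 0 := h2 h1
    simp [h3]

/-- If `z` is a conic combination of rows `i ∈ V`, then its norm is controlled by the positive
coordinates of `L z` in `V`. -/
lemma norm_le_of_conic {L : E →ₗ[ℝ] EuclideanSpace ℝ ι} (hL : Function.Injective L) {C : ℝ}
    (hC0 : 0 ≤ C) (hC : RowBound L C) {V : Finset ι} {c : ι → ℝ} (hc : ∀ i ∈ V, 0 ≤ c i) {z : E}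
    (hz : ∀ w, inner ℝ z w = ∑ i ∈ V, c i * L w i) {r : EuclideanSpace ℝ ι}
    (hr : ∀ i ∈ V, L z i ≤ r i) : ‖z‖ ≤ C * ‖r‖ := by
  classical
  obtain ⟨K, hKV, hK, c', hc', hsum⟩ := exists_linearIndepOn_nonneg_sum (rowForm L) V c hc
  have hz' (w : E) : inner ℝ z w = ∑ i ∈ K, c' i * L w i := by
    rw [hz]
    have := LinearMap.congr_fun hsum w
    simpa [rowForm] using this.symm
  obtain ⟨J, hKJ, hJ, hdet⟩ := exists_determines_extension hL hK
  -- Independence of J allows these values, and determination bounds y by C‖r‖. Since c' ≥ 0 and Lz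
  -- ≤ r = Ly on K, ‖z‖² ≤ ⟨z, y⟩.
  obtain ⟨y, hy⟩ := exists_forall_apply_eq hJ fun i => if i ∈ K then r i else 0
  have hy (i : ι) (hi : i ∈ J) : L y i = if i ∈ K then r i else 0 := hy i hi
  have hyn : ‖y‖ ≤ C * ‖r‖ := (hC J hdet y).trans <| mul_le_mul_of_nonneg_left
    (partNorm_le_norm _ fun i hi => by
      rw [hy i hi]
      split_ifs
      · rfl
      · simpa using sq_nonneg (r i)) hC0
  have h1 : ‖z‖ ^ 2 ≤ ‖z‖ * ‖y‖ := by
    calc ‖z‖ ^ 2 = inner ℝ z z := (real_inner_self_eq_norm_sq z).symm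
      _ = ∑ i ∈ K, c' i * L z i := hz' z
      _ ≤ ∑ i ∈ K, c' i * L y i := Finset.sum_le_sum fun i hi => by
          rw [hy i (hKJ hi), if_pos hi]
          exact mul_le_mul_of_nonneg_left (hr i (hKV hi)) (hc' i hi)
      _ = inner ℝ z y := (hz' y).symm
      _ ≤ ‖z‖ * ‖y‖ := real_inner_le_norm z y
  by_cases h0 : ‖z‖ = 0
  · rw [h0]; positivity
  · rw [sq] at h1
    exact (le_of_mul_le_mul_left h1 (lt_of_le_of_ne (norm_nonneg _) (Ne.symm h0))).trans hyn

/-- A quadratic majorant of the penalty, touching at h = 0; it yields first order optimality without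
differentiating. -/
lemma max_add_zero_sq_le (a h : ℝ) : max (a + h) 0 ^ 2 ≤ (max a 0 + h) ^ 2 := by
  rcases le_total 0 a with ha | ha <;> rcases le_total 0 (a + h) with hb | hb <;>
    simp only [max_eq_left, max_eq_right, ha, hb] <;> nlinarith

/-- Minimising the distance to `x` with a quadratic penalty on the violated inequalities
moves `x` by at most `C` times the violation. -/
lemma exists_penalty_minimizer {L : E →ₗ[ℝ] EuclideanSpace ℝ ι} (hL : Function.Injective L) {C : ℝ}
    (hC0 : 0 ≤ C) (hC : RowBound L C) (b : EuclideanSpace ℝ ι) (x p : E) (hp : ∀ i, L p i ≤ b i)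
    {k : ℝ} (hk : 0 < k) :
    ∃ u, ‖u - x‖ ≤ C * ‖positivePart (L x - b)‖ ∧
      k * ∑ i, max (L u i - b i) 0 ^ 2 ≤ ‖p - x‖ ^ 2 := by
  classical
  have hLc : Continuous L := L.continuous_of_finiteDimensional
  let f : E → ℝ := fun u => ‖u - x‖ ^ 2 + k * ∑ i, max (L u i - b i) 0 ^ 2
  have hpen (u : E) : 0 ≤ k * ∑ i, max (L u i - b i) 0 ^ 2 := by positivity
  have hf : Continuous f := by fun_prop
  have hfp : f p = ‖p - x‖ ^ 2 := by
    have (i : ι) : max (L p i - b i) 0 = 0 := max_eq_right (by linarith [hp i])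
    simp [f, this]
  obtain ⟨u, hu⟩ := hf.exists_forall_le_of_isBounded p <| by
    refine (Metric.isBounded_closedBall (x := x) (r := ‖p - x‖)).subset fun u hu => ?_
    have hu : f u ≤ f p := hu
    rw [hfp] at hu
    rw [mem_closedBall_iff_norm]
    exact le_of_sq_le_sq (by linarith [hpen u]) (norm_nonneg _)
  refine ⟨u, ?_, ?_⟩
  · have hstat (w : E) :
        inner ℝ (u - x) w + ∑ i, k * max (L u i - b i) 0 * L w i = 0 := by
      refine eq_zero_of_quadratic_nonneg (Q := ‖w‖ ^ 2 + k * ∑ i, L w i ^ 2) fun t => ?_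
      have h1 := hu (u + t • w)
      have h2 : ‖u + t • w - x‖ ^ 2 = ‖u - x‖ ^ 2 + 2 * t * inner ℝ (u - x) w + t ^ 2 * ‖w‖ ^ 2 := by
        rw [← norm_add_smul_sq]; congr 2; abel
      have h3 : ∑ i, max (L (u + t • w) i - b i) 0 ^ 2 ≤
          ∑ i, (max (L u i - b i) 0 + t * L w i) ^ 2 := Finset.sum_le_sum fun i _ => by
        have h : L (u + t • w) i - b i = L u i - b i + t * L w i := by
          simp only [map_add, map_smul, PiLp.add_apply, PiLp.smul_apply, smul_eq_mul]
          ring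
        rw [h]
        exact max_add_zero_sq_le _ _
      have h4 : k * ∑ i, (max (L u i - b i) 0 + t * L w i) ^ 2 =
          k * ∑ i, max (L u i - b i) 0 ^ 2 + 2 * t * ∑ i, k * max (L u i - b i) 0 * L w i
            + t ^ 2 * (k * ∑ i, L w i ^ 2) := by
        simp only [Finset.mul_sum, ← Finset.sum_add_distrib]
        exact Finset.sum_congr rfl fun i _ => by ring
      have h5 := mul_le_mul_of_nonneg_left h3 hk.le
      simp only [f] at h1
      rw [h2] at h1
      linarith
    -- By stationarity x - u is a conic combination of the rows violated at u. On these Lu > b, so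
    -- L(x - u) < Lx - b ≤ (Lx - b)₊.
    rw [norm_sub_rev]
    refine norm_le_of_conic hL hC0 hC (V := Finset.univ.filter fun i => 0 < L u i - b i)
      (c := fun i => k * max (L u i - b i) 0) (fun i _ => by positivity) (fun w => ?_)
      (fun i hi => ?_)
    · rw [Finset.sum_filter_of_ne]
      · have := hstat w
        rw [← neg_sub u x, inner_neg_left]
        linarith
      · intro i _ hi
        by_contra! h
        simp [max_eq_right h] at hi
    · have := (Finset.mem_filter.1 hi).2
      have h1 : L x i - b i ≤ max (L x i - b i) 0 := le_max_left _ _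
      simp only [positivePart, map_sub, PiLp.sub_apply]
      linarith
  · have := hu p
    rw [hfp] at this
    have h2 : 0 ≤ ‖u - x‖ ^ 2 := by positivity
    simp only [f] at this
    linarith

/-- A row bound is a Hoffman error bound. -/
lemma exists_feasible_norm_sub_le {L : E →ₗ[ℝ] EuclideanSpace ℝ ι} (hL : Function.Injective L)
    {C : ℝ} (hC0 : 0 ≤ C) (hC : RowBound L C) (b : EuclideanSpace ℝ ι) (x p : E)
    (hp : ∀ i, L p i ≤ b i) :
    ∃ u, (∀ i, L u i ≤ b i) ∧ ‖u - x‖ ≤ C * ‖positivePart (L x - b)‖ := by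
  have hLc : Continuous L := L.continuous_of_finiteDimensional
  set R := C * ‖positivePart (L x - b)‖
  have hR : 0 ≤ R := by positivity
  have hg : Continuous fun u => ∑ i, max (L u i - b i) 0 ^ 2 := by fun_prop
  -- Every penalty minimiser lies in this one ball, whatever k is. So the least violation over the
  -- ball is at most ‖p - x‖²/k for all k, hence zero.
  obtain ⟨u, hu, hmin⟩ := (isCompact_closedBall x R).exists_isMinOn
    ⟨x, by simpa using hR⟩ hg.continuousOn
  refine ⟨u, ?_, by rwa [mem_closedBall_iff_norm] at hu⟩
  have hle (k : ℝ) (hk : 0 < k) : k * ∑ i, max (L u i - b i) 0 ^ 2 ≤ ‖p - x‖ ^ 2 := by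
    obtain ⟨v, hv, hv'⟩ := exists_penalty_minimizer hL hC0 hC b x p hp hk
    refine le_trans (mul_le_mul_of_nonneg_left ?_ hk.le) hv'
    exact hmin (by rwa [mem_closedBall_iff_norm])
  have h0 : 0 ≤ ∑ i, max (L u i - b i) 0 ^ 2 := by positivity
  have hzero : ∑ i, max (L u i - b i) 0 ^ 2 = 0 := by
    by_contra hne
    have hpos := lt_of_le_of_ne h0 (Ne.symm hne)
    have := hle ((‖p - x‖ ^ 2 + 1) / ∑ i, max (L u i - b i) 0 ^ 2) (by positivity)
    rw [div_mul_cancel₀ _ hne] at this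
    linarith
  intro i
  rw [Finset.sum_eq_zero_iff_of_nonneg fun _ _ => sq_nonneg _] at hzero
  have := pow_eq_zero_iff two_ne_zero |>.1 (hzero i (Finset.mem_univ i))
  linarith [le_max_left (L u i - b i) 0]

end HoffmanBound

/-! ### Extremal row sets and concentrated weights -/

section Extremal

variable {ι E : Type*} [Fintype ι] [NormedAddCommGroup E] [InnerProductSpace ℝ E]

/-- Row bounds pass to a system whose rows are signed copies of the given rows. -/
lemma RowBound.of_abs_eq {ι' : Type*} [Fintype ι'] {L : E →ₗ[ℝ] EuclideanSpace ℝ ι}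
    {L' : E →ₗ[ℝ] EuclideanSpace ℝ ι'} {C : ℝ} (hC0 : 0 ≤ C) (hC : RowBound L C) (f : ι' → ι)
    (hf : ∀ y i, |L' y i| = |L y (f i)|) : RowBound L' C := by
  classical
  intro J hJ y
  -- Several rows may map to one row of L; merging them only shrinks the sum of squares.
  have hdet : Determines L (J.image f) := fun z hz => hJ z fun i hi => by
    rw [← abs_eq_zero, hf, hz _ (Finset.mem_image_of_mem f hi), abs_zero]
  refine (hC _ hdet y).trans (mul_le_mul_of_nonneg_left (Real.sqrt_le_sqrt ?_) hC0)
  refine (Finset.sum_image_le_of_nonneg fun _ _ => sq_nonneg _).trans_eq ?_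
  exact Finset.sum_congr rfl fun i _ => (sq_eq_sq_iff_abs_eq_abs _ _).2 (hf y i).symm

/-- First order optimality for a vector attaining a row bound. -/
lemma sum_mul_eq_of_extremal {L : E →ₗ[ℝ] EuclideanSpace ℝ ι} {J : Finset ι}
    (hJ : Determines L J) {y : E} (hy : y ≠ 0) (hC : RowBound L (‖y‖ / partNorm J (L y))) (z : E) :
    ∑ i ∈ J, L y i * L z i = (partNorm J (L y) / ‖y‖) ^ 2 * inner ℝ y z := by
  have hy0 : 0 < ‖y‖ := norm_pos_iff.2 hy
  have hN : 0 < partNorm J (L y) := partNorm_pos hJ hy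
  set σ := partNorm J (L y) / ‖y‖ with hσ
  have hσ0 : 0 < σ := by positivity
  -- Here σ is the least singular value of the rows in J; equality at y makes the first variation
  -- vanish.
  have hle (w : E) : σ ^ 2 * ‖w‖ ^ 2 ≤ ∑ i ∈ J, L w i ^ 2 := by
    rw [← partNorm_sq, ← mul_pow]
    refine pow_le_pow_left₀ (by positivity) ?_ 2
    have := hC J hJ w
    rw [hσ, div_mul_eq_mul_div, div_le_iff₀ hy0]
    rw [div_mul_eq_mul_div, le_div_iff₀ hN] at this
    linarith
  have heq : σ ^ 2 * ‖y‖ ^ 2 = ∑ i ∈ J, L y i ^ 2 := by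
    rw [← partNorm_sq, ← mul_pow, hσ, div_mul_cancel₀ _ hy0.ne']
  rw [← sub_eq_zero]
  refine eq_zero_of_quadratic_nonneg (Q := ∑ i ∈ J, L z i ^ 2 - σ ^ 2 * ‖z‖ ^ 2) fun t => ?_
  have h1 := hle (y + t • z)
  have h2 : ∑ i ∈ J, L (y + t • z) i ^ 2 = ∑ i ∈ J, L y i ^ 2 + 2 * t * ∑ i ∈ J, L y i * L z i
      + t ^ 2 * ∑ i ∈ J, L z i ^ 2 := by
    simp only [Finset.mul_sum, ← Finset.sum_add_distrib]
    refine Finset.sum_congr rfl fun i _ => ?_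
    simp only [map_add, map_smul, PiLp.add_apply, PiLp.smul_apply, smul_eq_mul]
    ring
  rw [norm_add_smul_sq, h2] at h1
  linarith

variable [FiniteDimensional ℝ E]

/-- The best row bound is attained. -/
lemma exists_extremal [Nontrivial E] {L : E →ₗ[ℝ] EuclideanSpace ℝ ι} (hL : Function.Injective L) :
    ∃ J y, Determines L J ∧ y ≠ 0 ∧ RowBound L (‖y‖ / partNorm J (L y)) := by
  classical
  have hLc : Continuous L := L.continuous_of_finiteDimensional
  have hmin (J : Finset ι) : ∃ y ∈ Metric.sphere (0 : E) 1, ∀ z ∈ Metric.sphere (0 : E) 1,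
      partNorm J (L y) ≤ partNorm J (L z) :=
    (isCompact_sphere (0 : E) 1).exists_isMinOn (NormedSpace.sphere_nonempty.2 zero_le_one)
      ((continuous_partNorm J).comp hLc).continuousOn
  choose y hy hymin using hmin
  obtain ⟨J, hJ, hJmin⟩ := (Finset.univ.filter fun J : Finset ι => Determines L J).exists_min_image
    (fun J => partNorm J (L (y J))) ⟨Finset.univ, by simpa using determines_univ hL⟩
  have hdet := (Finset.mem_filter.1 hJ).2
  have hy1 : ‖y J‖ = 1 := mem_sphere_zero_iff_norm.1 (hy J)
  have hy0 : y J ≠ 0 := norm_ne_zero_iff.1 (by simp [hy1])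
  refine ⟨J, y J, hdet, hy0, fun J' hJ' z => ?_⟩
  have hN := partNorm_pos hdet hy0
  by_cases hz : z = 0
  · rw [hz, norm_zero]
    exact mul_nonneg (by positivity) (partNorm_nonneg _ _)
  have hz0 : 0 < ‖z‖ := norm_pos_iff.2 hz
  rw [hy1, div_mul_eq_mul_div, one_mul, le_div_iff₀ hN, ← le_div_iff₀' hz0]
  calc partNorm J (L (y J)) ≤ partNorm J' (L (y J')) := hJmin J' (by simpa using hJ')
    _ ≤ partNorm J' (L (‖z‖⁻¹ • z)) := hymin J' _ (by simp [norm_smul, hz0.ne'])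
    _ = partNorm J' (L z) / ‖z‖ := by
      rw [map_smul, partNorm_smul, abs_of_pos (inv_pos.2 hz0), inv_mul_eq_div]

/-- Concentrating the weights on `J` recovers `y` from its `J`-coordinates. -/
lemma norm_le_of_weighted_solutions_le {L : E →ₗ[ℝ] EuclideanSpace ℝ ι} {C M : ℝ} (hM0 : 0 ≤ M)
    (hM : RowBound L M)
    (hC : ∀ d : ι → ℝ, (∀ i, 0 < d i) → ∀ b : EuclideanSpace ℝ ι, ∃ x,
      (∀ z, ∑ i, d i * (L x i - b i) * L z i = 0) ∧ ‖x‖ ≤ C * ‖b‖)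
    {J : Finset ι} (hJ : Determines L J) (y : E) : ‖y‖ ≤ C * partNorm J (L y) := by
  classical
  let b : EuclideanSpace ℝ ι := WithLp.toLp 2 fun i => if i ∈ J then L y i else 0
  have hb : ‖b‖ = partNorm J (L y) := by
    rw [EuclideanSpace.norm_eq, partNorm, ← Finset.sum_filter_add_sum_filter_not _ (· ∈ J)]
    congr 1
    rw [Finset.sum_eq_zero (s := Finset.univ.filter fun i => i ∉ J), add_zero]
    · simp only [Finset.filter_mem_eq_inter, Finset.univ_inter]
      exact Finset.sum_congr rfl fun i hi => by simp [b, hi]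
    · intro i hi
      simp [b, (Finset.mem_filter.1 hi).2]
  have key (δ : ℝ) (hδ : 0 < δ) : ‖y‖ ≤ C * partNorm J (L y) + M * ‖L y‖ * δ := by
    -- Testing the normal equations with x - y bounds its J-part by δ‖Ly‖. The a priori bound M then
    -- gives x → y as δ → 0.
    obtain ⟨x, hx, hxC⟩ := hC (fun i => if i ∈ J then 1 else δ ^ 2)
      (fun i => by split_ifs <;> positivity) b
    have h1 : partNorm J (L (x - y)) ≤ ‖δ • L y‖ := by
      rw [EuclideanSpace.norm_eq]
      refine Real.sqrt_le_sqrt ?_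
      have h2 := hx (x - y)
      rw [← Finset.sum_filter_add_sum_filter_not _ (· ∈ J)] at h2
      have h3 : ∑ i with i ∈ J, (if i ∈ J then 1 else δ ^ 2) * (L x i - b i) * L (x - y) i
          = ∑ i ∈ J, L (x - y) i ^ 2 := by
        simp only [Finset.filter_mem_eq_inter, Finset.univ_inter]
        refine Finset.sum_congr rfl fun i hi => ?_
        simp [b, hi, sq]
      rw [h3] at h2
      have h4 : -∑ i with i ∉ J, (if i ∈ J then 1 else δ ^ 2) * (L x i - b i) * L (x - y) i
          ≤ ∑ i with i ∉ J, ‖(δ • L y) i‖ ^ 2 := by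
        rw [← Finset.sum_neg_distrib]
        refine Finset.sum_le_sum fun i hi => ?_
        have hi := (Finset.mem_filter.1 hi).2
        simp only [hi, if_false, b, map_sub, PiLp.sub_apply, PiLp.smul_apply, smul_eq_mul,
          Real.norm_eq_abs, sq_abs, sub_zero, mul_pow]
        nlinarith [sq_nonneg (δ * (2 * L x i - L y i)), sq_nonneg (δ * L y i)]
      have h5 : ∑ i with i ∉ J, ‖(δ • L y) i‖ ^ 2 ≤ ∑ i, ‖(δ • L y) i‖ ^ 2 :=
        Finset.sum_le_sum_of_subset_of_nonneg (Finset.subset_univ _) fun _ _ _ => sq_nonneg _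
      linarith
    have h6 : ‖x - y‖ ≤ M * (δ * ‖L y‖) := by
      refine (hM J hJ _).trans (mul_le_mul_of_nonneg_left (h1.trans_eq ?_) hM0)
      rw [norm_smul, Real.norm_of_nonneg hδ.le]
    have h7 : ‖y‖ ≤ ‖x‖ + ‖x - y‖ := by
      have := norm_sub_le x (x - y)
      rwa [sub_sub_cancel] at this
    rw [hb] at hxC
    linarith
  refine le_of_forall_pos_le_add fun ε hε => ?_
  have hK : 0 ≤ M * ‖L y‖ := by positivity
  refine (key (ε / (M * ‖L y‖ + 1)) (by positivity)).trans ?_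
  gcongr
  rw [mul_div_assoc', div_le_iff₀ (by positivity)]
  nlinarith

end Extremal

/-! ### Transfer to matrices, signs and the two constants -/

section Matrices

open scoped Matrix Pointwise Matrix.Norms.L2Operator

variable {ι κ : Type*} [Fintype ι] [DecidableEq ι] [Fintype κ] [DecidableEq κ]

lemma toEuclideanLin_apply_eq_sum (B : Matrix ι κ ℝ) (x : EuclideanSpace ℝ κ) (i : ι) :
    B.toEuclideanLin x i = ∑ j, B i j * x j := rfl

lemma sum_mul_toEuclideanLin (A : Matrix ι κ ℝ) (c : ι → ℝ) (z : EuclideanSpace ℝ κ) :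
    ∑ i, c i * A.toEuclideanLin z i = (Aᵀ *ᵥ c) ⬝ᵥ z.ofLp := by
  rw [Matrix.mulVec_transpose, ← Matrix.dotProduct_mulVec]
  rfl

/-- Injectivity makes AᵀDA positive definite, so the inverse is genuine and AᵀD(Ax - b) = 0 can be
paired with z. -/
lemma toEuclideanLin_weightedPinv {A : Matrix ι κ ℝ} (hA : Function.Injective A.toEuclideanLin)
    {d : ι → ℝ} (hd : ∀ i, 0 < d i) (b : EuclideanSpace ℝ ι) (z : EuclideanSpace ℝ κ) :
    ∑ i, d i * (A.toEuclideanLin ((weightedPinv A (Matrix.diagonal d)).toEuclideanLin b) i - b i) *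
      A.toEuclideanLin z i = 0 := by
  have hinj : Function.Injective A.mulVec := fun u v huv => by
    have := @hA (WithLp.toLp 2 u) (WithLp.toLp 2 v) (congrArg (WithLp.toLp 2) huv)
    simpa using this
  have hunit : IsUnit (Aᵀ * Matrix.diagonal d * A).det := by
    have := ((Matrix.PosDef.diagonal hd).conjTranspose_mul_mul_same hinj).isUnit
    rw [Matrix.isUnit_iff_isUnit_det] at this
    rwa [Matrix.conjTranspose_eq_transpose_of_trivial] at this
  rw [sum_mul_toEuclideanLin A
    (fun i => d i * (A.toEuclideanLin ((weightedPinv A (Matrix.diagonal d)).toEuclideanLin b) i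
      - b i))]
  have h1 : (fun i => d i * (A.toEuclideanLin
        ((weightedPinv A (Matrix.diagonal d)).toEuclideanLin b) i - b i)) =
      Matrix.diagonal d *ᵥ (A *ᵥ (weightedPinv A (Matrix.diagonal d) *ᵥ b.ofLp) - b.ofLp) := by
    ext i
    rw [Matrix.mulVec_diagonal]
    rfl
  have h2 : Aᵀ * Matrix.diagonal d * A * weightedPinv A (Matrix.diagonal d) =
      Aᵀ * Matrix.diagonal d := by
    rw [weightedPinv, Matrix.mul_assoc (_)⁻¹, Matrix.mul_nonsing_inv_cancel_left _ _ hunit]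
  rw [h1, Matrix.mulVec_sub, Matrix.mulVec_sub, Matrix.mulVec_mulVec, Matrix.mulVec_mulVec,
    Matrix.mulVec_mulVec, Matrix.mulVec_mulVec, h2, sub_self, zero_dotProduct]

lemma norm_toEuclideanLin_le (W : Matrix κ ι ℝ) (b : EuclideanSpace ℝ ι) :
    ‖W.toEuclideanLin b‖ ≤ ‖W‖ * ‖b‖ := W.l2_opNorm_mulVec b

lemma l2_opNorm_le {W : Matrix κ ι ℝ} {C : ℝ} (hC0 : 0 ≤ C)
    (h : ∀ b, ‖W.toEuclideanLin b‖ ≤ C * ‖b‖) : ‖W‖ ≤ C := by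
  rw [Matrix.l2_opNorm_def]
  exact ContinuousLinearMap.opNorm_le_bound _ hC0 h

lemma chiValues_le {A : Matrix ι κ ℝ} (hA : Function.Injective A.toEuclideanLin) {C : ℝ}
    (hC0 : 0 ≤ C) (hC : RowBound A.toEuclideanLin C) {r : ℝ} (hr : r ∈ chiValues A) : r ≤ C := by
  obtain ⟨D, ⟨d, hd, rfl⟩, rfl⟩ := hr
  exact l2_opNorm_le hC0 fun b =>
    norm_le_of_weighted_normal_equations hA hC0 hC hd (toEuclideanLin_weightedPinv hA hd b)

lemma chiValues_nonempty (A : Matrix ι κ ℝ) : (chiValues A).Nonempty :=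
  ⟨_, Matrix.diagonal 1, ⟨1, fun _ => one_pos, rfl⟩, rfl⟩

/-- The extremal ratio serves twice: as the upper bound, and as the a priori bound when weights
concentrate on J. -/
lemma chi_eq_of_extremal {A : Matrix ι κ ℝ} {J : Finset ι} {y : EuclideanSpace ℝ κ}
    (hJ : Determines A.toEuclideanLin J) (hy : y ≠ 0)
    (hC : RowBound A.toEuclideanLin (‖y‖ / partNorm J (A.toEuclideanLin y))) :
    chi A = ‖y‖ / partNorm J (A.toEuclideanLin y) := by
  have hN := partNorm_pos hJ hy
  have hM0 : 0 ≤ ‖y‖ / partNorm J (A.toEuclideanLin y) := by positivity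
  refine (isLUB_csSup (chiValues_nonempty A)
    ⟨_, fun r hr => chiValues_le hJ.injective hM0 hC hr⟩).unique
    ⟨fun r hr => chiValues_le hJ.injective hM0 hC hr, fun C hCub => ?_⟩
  rw [div_le_iff₀ hN]
  refine norm_le_of_weighted_solutions_le hM0 hC (fun d hd b =>
    ⟨_, toEuclideanLin_weightedPinv hJ.injective hd b, (norm_toEuclideanLin_le _ b).trans ?_⟩) hJ y
  exact mul_le_mul_of_nonneg_right (hCub ⟨_, ⟨d, hd, rfl⟩, rfl⟩) (norm_nonneg _)

lemma hoffmanValues_le {B : Matrix ι κ ℝ} (hB : Function.Injective B.toEuclideanLin) {C : ℝ}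
    (hC0 : 0 ≤ C) (hC : RowBound B.toEuclideanLin C) {r : ℝ} (hr : r ∈ hoffmanValues B) :
    r ≤ C := by
  obtain ⟨b, hb, x, -, rfl⟩ := hr
  obtain ⟨_, ⟨p, rfl⟩, v, hv, rfl⟩ := hb
  obtain ⟨u, hu, hux⟩ := exists_feasible_norm_sub_le hB hC0 hC (B.toEuclideanLin p + v) x p
    fun i => by simpa using hv i
  refine div_le_of_le_mul₀ (norm_nonneg _) hC0 ?_
  refine (Metric.infDist_le_dist_of_mem (show u ∈ polyhedron B _ from hu)).trans ?_
  rwa [dist_comm, dist_eq_norm]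

/-- A vector `y` in the cone spanned by the rows in `J`, with coefficients proportional to its own
`J`-coordinates, realises a Hoffman ratio. -/
lemma mem_hoffmanValues {B : Matrix ι κ ℝ} {J : Finset ι} {y : EuclideanSpace ℝ κ} (hy : y ≠ 0)
    {s : ℝ} (hs : 0 < s) (hpos : ∀ i ∈ J, 0 ≤ B.toEuclideanLin y i)
    (hstat : ∀ z, ∑ i ∈ J, B.toEuclideanLin y i * B.toEuclideanLin z i = s * inner ℝ y z) :
    ‖y‖ / partNorm J (B.toEuclideanLin y) ∈ hoffmanValues B := by
  set L := B.toEuclideanLin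
  have hyy : 0 < s * inner ℝ y y := mul_pos hs (real_inner_self_pos.2 hy)
  -- Rows outside J hold at y and contribute no violation, while 0 stays feasible.
  let b : EuclideanSpace ℝ ι := WithLp.toLp 2 fun i => if i ∈ J then 0 else |L y i|
  have hb0 (i : ι) : 0 ≤ b i := by
    simp only [b]; split_ifs <;> positivity
  refine ⟨b, ⟨0, ⟨0, map_zero _⟩, b, hb0, zero_add b⟩, y, fun hmem => ?_, ?_⟩
  · rw [← hstat y] at hyy
    refine hyy.ne' (Finset.sum_eq_zero fun i hi => ?_)
    have h1 : L y i ≤ b i := hmem i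
    simp only [b, hi, if_true] at h1
    rw [le_antisymm h1 (hpos i hi), zero_mul]
  · have h0 : (0 : EuclideanSpace ℝ κ) ∈ polyhedron B b := fun i => by
      rw [map_zero]; exact hb0 i
    have hdist : Metric.infDist y (polyhedron B b) = ‖y‖ := by
      apply le_antisymm
      · simpa using Metric.infDist_le_dist_of_mem (x := y) h0
      · refine (Metric.le_infDist ⟨0, h0⟩).2 fun p hp => ?_
        -- y is in the normal cone at 0, so no feasible p is closer to y than 0.
        have h1 : inner ℝ y p ≤ 0 := by
          refine nonpos_of_mul_nonpos_right (a := s) ?_ hs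
          rw [← hstat p]
          refine Finset.sum_nonpos fun i hi => mul_nonpos_of_nonneg_of_nonpos (hpos i hi) ?_
          have h2 : L p i ≤ b i := hp i
          simpa [b, hi] using h2
        rw [dist_eq_norm]
        refine le_of_sq_le_sq ?_ (norm_nonneg _)
        rw [norm_sub_sq_real]
        nlinarith [sq_nonneg ‖p‖]
    have hpart : ‖positivePart (L y - b)‖ = partNorm J (L y) := by
      rw [EuclideanSpace.norm_eq, partNorm, ← Finset.sum_filter_add_sum_filter_not _ (· ∈ J)]
      congr 1
      rw [Finset.sum_eq_zero (s := Finset.univ.filter fun i => i ∉ J), add_zero]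
      · simp only [Finset.filter_mem_eq_inter, Finset.univ_inter]
        exact Finset.sum_congr rfl fun i hi => by simp [b, positivePart, hi, hpos i hi]
      · intro i hi
        simp [b, positivePart, (Finset.mem_filter.1 hi).2, le_abs_self]
    rw [hdist, hpart]

lemma injective_of_abs_eq {ι' : Type*} [Fintype ι'] [DecidableEq ι'] {A : Matrix ι κ ℝ}
    {B : Matrix ι' κ ℝ} (hA : Function.Injective A.toEuclideanLin) {f : ι' → ι}
    (hf : Function.Surjective f)
    (h : ∀ y i, |B.toEuclideanLin y i| = |A.toEuclideanLin y (f i)|) :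
    Function.Injective B.toEuclideanLin := by
  rw [injective_iff_map_eq_zero]
  intro y hy
  apply (injective_iff_map_eq_zero _).1 hA
  ext i
  obtain ⟨j, rfl⟩ := hf i
  have := h y j
  rw [hy] at this
  simpa [eq_comm] using this

lemma toEuclideanLin_diagonal_mul (s : ι → ℝ) (A : Matrix ι κ ℝ) (y : EuclideanSpace ℝ κ) (i : ι) :
    (Matrix.diagonal s * A).toEuclideanLin y i = s i * A.toEuclideanLin y i := by
  simp only [toEuclideanLin_apply_eq_sum, Matrix.diagonal_mul, Finset.mul_sum, mul_assoc]

lemma toEuclideanLin_fromRows_neg_inl (A : Matrix ι κ ℝ) (y : EuclideanSpace ℝ κ) (i : ι) :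
    (Matrix.fromRows A (-A)).toEuclideanLin y (Sum.inl i) = A.toEuclideanLin y i := rfl

lemma toEuclideanLin_fromRows_neg_inr (A : Matrix ι κ ℝ) (y : EuclideanSpace ℝ κ) (i : ι) :
    (Matrix.fromRows A (-A)).toEuclideanLin y (Sum.inr i) = -A.toEuclideanLin y i := by
  simp [toEuclideanLin_apply_eq_sum]

lemma abs_toEuclideanLin_diagonal_mul {s : ι → ℝ} (hs : ∀ i, s i = -1 ∨ s i = 1)
    (A : Matrix ι κ ℝ) (y : EuclideanSpace ℝ κ) (i : ι) :
    |(Matrix.diagonal s * A).toEuclideanLin y i| = |A.toEuclideanLin y i| := by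
  rw [toEuclideanLin_diagonal_mul, abs_mul]
  rcases hs i with h | h <;> simp [h]

lemma abs_toEuclideanLin_fromRows_neg (A : Matrix ι κ ℝ) (y : EuclideanSpace ℝ κ) (i : ι ⊕ ι) :
    |(Matrix.fromRows A (-A)).toEuclideanLin y i| = |A.toEuclideanLin y (Sum.elim id id i)| := by
  rcases i with i | i
  · rw [toEuclideanLin_fromRows_neg_inl]; rfl
  · rw [toEuclideanLin_fromRows_neg_inr, abs_neg]; rfl

/-- The Hoffman bound for a system of signed copies of the rows of `A`. -/
lemma hoffmanValues_le_of_abs_eq {ι' : Type*} [Fintype ι'] [DecidableEq ι'] {A : Matrix ι κ ℝ}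
    {B : Matrix ι' κ ℝ} (hA : Function.Injective A.toEuclideanLin) {C : ℝ} (hC0 : 0 ≤ C)
    (hC : RowBound A.toEuclideanLin C) {f : ι' → ι} (hf : Function.Surjective f)
    (h : ∀ y i, |B.toEuclideanLin y i| = |A.toEuclideanLin y (f i)|) :
    ∀ r ∈ hoffmanValues B, r ≤ C := fun _ hr =>
  hoffmanValues_le (injective_of_abs_eq hA hf h) hC0 (hC.of_abs_eq hC0 f h) hr

lemma surjective_sum_elim_id : Function.Surjective (Sum.elim id id : ι ⊕ ι → ι) :=
  fun i => ⟨Sum.inl i, rfl⟩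

/-- Signs making the image of an extremal vector nonnegative give the extremal Hoffman ratio. -/
lemma extremal_mem_hoffmanValues_signature {A : Matrix ι κ ℝ} {J : Finset ι}
    {y : EuclideanSpace ℝ κ} (hJ : Determines A.toEuclideanLin J) (hy : y ≠ 0)
    (hC : RowBound A.toEuclideanLin (‖y‖ / partNorm J (A.toEuclideanLin y))) {s : ι → ℝ}
    (hs : ∀ i, s i = -1 ∨ s i = 1) (hsy : ∀ i, 0 ≤ s i * A.toEuclideanLin y i) :
    ‖y‖ / partNorm J (A.toEuclideanLin y) ∈ hoffmanValues (Matrix.diagonal s * A) := by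
  have hs2 (i : ι) : s i * s i = 1 := by rcases hs i with h | h <;> simp [h]
  have hN : partNorm J ((Matrix.diagonal s * A).toEuclideanLin y) =
      partNorm J (A.toEuclideanLin y) := by
    unfold partNorm
    congr 1
    exact Finset.sum_congr rfl fun i _ => (sq_eq_sq_iff_abs_eq_abs _ _).2
      (abs_toEuclideanLin_diagonal_mul hs A y i)
  rw [← hN]
  have hpN := partNorm_pos hJ hy
  have hyn := norm_pos_iff.2 hy
  refine mem_hoffmanValues hy (s := (partNorm J (A.toEuclideanLin y) / ‖y‖) ^ 2) (by positivity)
    (fun i _ => by rw [toEuclideanLin_diagonal_mul]; exact hsy i) fun z => ?_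
  rw [← sum_mul_eq_of_extremal hJ hy hC z]
  refine Finset.sum_congr rfl fun i _ => ?_
  rw [toEuclideanLin_diagonal_mul, toEuclideanLin_diagonal_mul, mul_mul_mul_comm, hs2, one_mul]

lemma extremal_mem_hoffmanValues_fromRows {A : Matrix ι κ ℝ} {J : Finset ι}
    {y : EuclideanSpace ℝ κ} (hJ : Determines A.toEuclideanLin J) (hy : y ≠ 0)
    (hC : RowBound A.toEuclideanLin (‖y‖ / partNorm J (A.toEuclideanLin y))) :
    ‖y‖ / partNorm J (A.toEuclideanLin y) ∈ hoffmanValues (Matrix.fromRows A (-A)) := by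
  -- Choosing the copy of each row that is nonnegative at y plays the role of the signature.
  let e : ι → ι ⊕ ι := fun i => if 0 ≤ A.toEuclideanLin y i then Sum.inl i else Sum.inr i
  have he : Function.Injective e := fun i j hij => by
    simp only [e] at hij
    split_ifs at hij <;> simpa using hij
  have hval (i : ι) : 0 ≤ (Matrix.fromRows A (-A)).toEuclideanLin y (e i) := by
    simp only [e]
    split_ifs with h
    · rwa [toEuclideanLin_fromRows_neg_inl]
    · rw [toEuclideanLin_fromRows_neg_inr]; linarith
  have hmul (z : EuclideanSpace ℝ κ) (i : ι) : (Matrix.fromRows A (-A)).toEuclideanLin y (e i) *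
      (Matrix.fromRows A (-A)).toEuclideanLin z (e i) =
        A.toEuclideanLin y i * A.toEuclideanLin z i := by
    simp only [e]
    split_ifs with h
    · simp only [toEuclideanLin_fromRows_neg_inl]
    · simp only [toEuclideanLin_fromRows_neg_inr, neg_mul_neg]
  have hN : partNorm (J.map ⟨e, he⟩) ((Matrix.fromRows A (-A)).toEuclideanLin y) =
      partNorm J (A.toEuclideanLin y) := by
    unfold partNorm
    rw [Finset.sum_map]
    congr 1
    exact Finset.sum_congr rfl fun i _ => by
      rw [sq, sq]; exact hmul y i
  rw [← hN]
  have hpN := partNorm_pos hJ hy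
  have hyn := norm_pos_iff.2 hy
  refine mem_hoffmanValues hy (s := (partNorm J (A.toEuclideanLin y) / ‖y‖) ^ 2) (by positivity)
    (fun i hi => ?_) fun z => ?_
  · obtain ⟨j, -, rfl⟩ := Finset.mem_map.1 hi
    exact hval j
  · rw [← sum_mul_eq_of_extremal hJ hy hC z, Finset.sum_map]
    exact Finset.sum_congr rfl fun i _ => hmul z i

lemma exists_nonneg_signs (v : ι → ℝ) :
    ∃ s : ι → ℝ, (∀ i, s i = -1 ∨ s i = 1) ∧ ∀ i, 0 ≤ s i * v i := by
  refine ⟨fun i => if 0 ≤ v i then 1 else -1, fun i => ?_, fun i => ?_⟩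
  · dsimp only; split_ifs <;> simp
  · dsimp only; split_ifs with h
    · simpa using h
    · linarith

/-- If no row of `A` vanishes, signs making `A y` nonnegative can be chosen so that some vector near
`y` has a positive image. -/
lemma exists_signs_posOrthant {A : Matrix ι κ ℝ} (hA : ∀ i, A i ≠ 0) (y : EuclideanSpace ℝ κ) :
    ∃ s : ι → ℝ, (∀ i, s i = -1 ∨ s i = 1) ∧ (∀ i, 0 ≤ s i * A.toEuclideanLin y i) ∧
      (image (Matrix.diagonal s * A) ∩ posOrthant ι).Nonempty := by
  -- Finitely many nonzero forms have a common point w of nonvanishing. Its signs settle the rows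
  -- vanishing at y, and y + tw with small t > 0 then has positive image.
  obtain ⟨w, hw⟩ := Module.Dual.exists_forall_ne_zero_of_forall_exists
    (fun i => rowForm A.toEuclideanLin i) fun i => by
      obtain ⟨j, hj⟩ := Function.ne_iff.1 (hA i)
      refine ⟨EuclideanSpace.single j 1, ?_⟩
      change A.toEuclideanLin (EuclideanSpace.single j 1) i ≠ 0
      simpa [toEuclideanLin_apply_eq_sum, PiLp.single_apply] using hj
  have hw (i : ι) : A.toEuclideanLin w i ≠ 0 := hw i
  have hsign (a : ℝ) (ha : a ≠ 0) : ∃ s : ℝ, (s = -1 ∨ s = 1) ∧ 0 < s * a := by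
    rcases lt_or_gt_of_ne ha with h | h
    · exact ⟨-1, Or.inl rfl, by linarith⟩
    · exact ⟨1, Or.inr rfl, by linarith⟩
  have hex (i : ι) : ∃ s : ℝ, (s = -1 ∨ s = 1) ∧ 0 ≤ s * A.toEuclideanLin y i ∧
      ∀ᶠ t in nhdsWithin (0 : ℝ) (Set.Ioi 0),
        0 < s * (A.toEuclideanLin y i + t * A.toEuclideanLin w i) := by
    by_cases h : A.toEuclideanLin y i = 0
    · obtain ⟨s, hs, hpos⟩ := hsign _ (hw i)
      refine ⟨s, hs, by simp [h], ?_⟩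
      filter_upwards [self_mem_nhdsWithin] with t ht
      rw [h, zero_add, mul_left_comm]
      exact mul_pos ht hpos
    · obtain ⟨s, hs, hpos⟩ := hsign _ h
      refine ⟨s, hs, hpos.le, Filter.Eventually.filter_mono nhdsWithin_le_nhds ?_⟩
      have hc : Continuous fun t : ℝ =>
          s * (A.toEuclideanLin y i + t * A.toEuclideanLin w i) := by fun_prop
      exact hc.continuousAt.eventually (lt_mem_nhds (by simpa using hpos))
  choose s hs hsy hev using hex
  obtain ⟨t, ht⟩ := (Filter.eventually_all.2 hev).exists
  refine ⟨s, hs, hsy, _, ⟨y + t • w, rfl⟩, fun i => ?_⟩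
  rw [toEuclideanLin_diagonal_mul]
  simpa using ht i

lemma toEuclideanLin_injective_of_rank {A : Matrix ι κ ℝ} (hA : A.rank = Fintype.card κ) :
    Function.Injective A.toEuclideanLin := by
  have h1 := A.mulVecLin.finrank_range_add_finrank_ker
  rw [Module.finrank_fintype_fun_eq_card] at h1
  have h2 : Module.finrank ℝ (LinearMap.ker A.mulVecLin) = 0 := by
    change A.rank + _ = _ at h1
    omega
  have h3 := LinearMap.ker_eq_bot.1 (Submodule.finrank_eq_zero.1 h2)
  intro u v huv
  have h4 : A.mulVecLin u.ofLp = A.mulVecLin v.ofLp := congrArg WithLp.ofLp huv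
  exact WithLp.ofLp_injective 2 (h3 h4)

lemma chiValues_eq_of_isEmpty [IsEmpty κ] (A : Matrix ι κ ℝ) : chiValues A = {0} := by
  have h (D : Matrix ι ι ℝ) : ‖weightedPinv A D‖ = 0 := by
    rw [Subsingleton.elim (weightedPinv A D) 0, norm_zero]
  ext r
  constructor
  · rintro ⟨D, -, rfl⟩
    exact h D
  · rintro rfl
    exact ⟨_, ⟨1, fun _ => one_pos, rfl⟩, (h _).symm⟩

lemma hoffmanValues_eq_of_isEmpty [IsEmpty κ] (B : Matrix ι κ ℝ) : hoffmanValues B = ∅ := by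
  refine Set.eq_empty_of_forall_notMem ?_
  rintro r ⟨_, ⟨_, ⟨p, rfl⟩, v, hv, rfl⟩, x, hx, -⟩
  refine hx fun i => ?_
  rw [Subsingleton.elim x p]
  simpa using hv i

end Matrices

end ChiHoffman

theorem theorem2 (m n : ℕ) (A : Matrix (Fin m) (Fin n) ℝ) (hA : A.rank = n) :
    -- all the constants involved are finite
    (BddAbove (ChiHoffman.chiValues A) ∧
      (∀ S ∈ ChiHoffman.signature (Fin m), BddAbove (ChiHoffman.hoffmanValues (S * A))) ∧
      BddAbove (ChiHoffman.hoffmanValues (Matrix.fromRows A (-A)))) ∧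
    IsGreatest {h : ℝ | ∃ S ∈ ChiHoffman.signature (Fin m), h = ChiHoffman.hoffman (S * A)}
      (ChiHoffman.chi A) ∧
    ChiHoffman.chi A = ChiHoffman.hoffman (Matrix.fromRows A (-A)) ∧
    ((∀ i, A i ≠ 0) →
      IsGreatest {h : ℝ | ∃ S ∈ ChiHoffman.signature (Fin m),
          (ChiHoffman.image (S * A) ∩ ChiHoffman.posOrthant (Fin m)).Nonempty ∧
          h = ChiHoffman.hoffman (S * A)}
        (ChiHoffman.chi A)) := by
  open ChiHoffman in
  -- For n = 0 there is no nonzero extremal vector; every constant is 0, the Hoffman ones by the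
  -- empty supremum.
  rcases isEmpty_or_nonempty (Fin n) with hn | hn
  · have hh {ι : Type} [Fintype ι] [DecidableEq ι] (B : Matrix ι (Fin n) ℝ) : hoffman B = 0 := by
      rw [hoffman, hoffmanValues_eq_of_isEmpty, Real.sSup_empty]
    have hchi : chi A = 0 := by rw [chi, chiValues_eq_of_isEmpty, csSup_singleton]
    simp only [hh, hchi, chiValues_eq_of_isEmpty, hoffmanValues_eq_of_isEmpty]
    refine ⟨⟨bddAbove_singleton, fun _ _ => bddAbove_empty, bddAbove_empty⟩,
      ⟨⟨_, ⟨1, fun _ => Or.inr rfl, rfl⟩, rfl⟩, ?_⟩, trivial, fun hrow => ⟨?_, ?_⟩⟩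
    · rintro _ ⟨_, _, rfl⟩; rfl
    · obtain ⟨s, hs, -, hpos⟩ := exists_signs_posOrthant hrow 0
      exact ⟨_, ⟨s, hs, rfl⟩, hpos, rfl⟩
    · rintro _ ⟨_, _, _, rfl⟩; rfl
  · have hinj := toEuclideanLin_injective_of_rank (A := A) (by simpa using hA)
    obtain ⟨J, y, hJ, hy, hC⟩ := exists_extremal hinj
    have hN := partNorm_pos hJ hy
    have hchi := chi_eq_of_extremal hJ hy hC
    have hS {s : Fin m → ℝ} (hs : ∀ i, s i = -1 ∨ s i = 1)
        (hsy : ∀ i, 0 ≤ s i * A.toEuclideanLin y i) :=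
      extremal_mem_hoffmanValues_signature hJ hy hC hs hsy
    have hR := extremal_mem_hoffmanValues_fromRows hJ hy hC
    rw [← hchi] at hC hR
    simp only [← hchi] at hS
    have hM0 : 0 ≤ chi A := by rw [hchi]; positivity
    have ubS {s : Fin m → ℝ} (hs : ∀ i, s i = -1 ∨ s i = 1) :=
      hoffmanValues_le_of_abs_eq hinj hM0 hC Function.surjective_id
        (abs_toEuclideanLin_diagonal_mul hs A)
    have ubR := hoffmanValues_le_of_abs_eq hinj hM0 hC surjective_sum_elim_id
      (abs_toEuclideanLin_fromRows_neg A)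
    have eqS {s : Fin m → ℝ} (hs : ∀ i, s i = -1 ∨ s i = 1)
        (hsy : ∀ i, 0 ≤ s i * A.toEuclideanLin y i) :
        chi A = hoffman (Matrix.diagonal s * A) :=
      (IsGreatest.csSup_eq ⟨hS hs hsy, ubS hs⟩).symm
    refine ⟨⟨⟨_, fun r hr => chiValues_le hinj hM0 hC hr⟩, ?_, ⟨_, ubR⟩⟩, ⟨?_, ?_⟩,
      (IsGreatest.csSup_eq ⟨hR, ubR⟩).symm, fun hrow => ⟨?_, ?_⟩⟩
    · rintro _ ⟨s, hs, rfl⟩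
      exact ⟨_, ubS hs⟩
    · obtain ⟨s, hs, hsy⟩ := exists_nonneg_signs fun i => A.toEuclideanLin y i
      exact ⟨_, ⟨s, hs, rfl⟩, eqS hs hsy⟩
    · rintro _ ⟨_, ⟨s, hs, rfl⟩, rfl⟩
      exact Real.sSup_le (ubS hs) hM0
    · obtain ⟨s, hs, hsy, hpos⟩ := exists_signs_posOrthant hrow y
      exact ⟨_, ⟨s, hs, rfl⟩, hpos, eqS hs hsy⟩
    · rintro _ ⟨_, ⟨s, hs, rfl⟩, -, rfl⟩
      exact Real.sSup_le (ubS hs) hM0
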